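/- For $n\ge 0$ let $\mathcal T_n$ be the set of rooted ordered (plane) trees with $n$ edges. The level of a node is its distance from the root. For a node $v$ of a tree, let $\mathrm{bfsScore}(v)$ (respectively $\mathrm{dfsScore}(v)$) be the number of nodes visited before $v$ by breadth-first search (respectively depth-first search, i.e. pre-order traversal) started at the root, children being taken from left to right. Let $\mathrm{totalB}(n,\ell)$ and $\mathrm{totalD}(n,\ell)$ be the sums of $\mathrm{bfsScore}(v)$ and of $\mathrm{dfsScore}(v)$, respectively, over all trees $T\in\mathcal T_n$ and all nodes $v$ of $T$ at level $\ell$. Let $\Phi$ be the cumulative distribution function of the standard normal distribution. **Theorem.** For every $n\ge 1$ there is a threshold $\lambda_n\in\mathbb R$ such that, for all integers $0\le \ell<n$, $$\mathrm{totalB}(n,\ell)\le \mathrm{totalD}(n,\ell)\iff \ell\le\lambda_n .$$ Equivalently, for $0\le\ell<n$, the expected BFS score is at most the expected DFS score for a target chosen uniformly at random among all (at least one) nodes at level $\ell$ in the trees of $\mathcal T_n$ if and only if $\ell\le\lambda_n$. Moreover, the equation $$x e^{-x^2}-2\sqrt{\pi}\,\bigl(\Phi(2\sqrt2\,x)-\Phi(\sqrt2\,x)\bigr)=0$$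 has a unique positive root $\lambda$, one has $\lambda\approx 0.789004$ (with error at most $5\cdot 10^{-7}$), and for every choice of thresholds $\lambda_n$ as above, $\lambda_n\sim\lambda\sqrt n$ as $n\to\infty$. -/

import Mathlib

/-- Rooted ordered (plane) trees: a root together with the ordered list of the subtrees
of its children. -/
inductive OrderedTree : Type
  | node (children : List OrderedTree) : OrderedTree

namespace OrderedTree

mutual
/-- The number of edges of an ordered tree. -/
def numEdges : OrderedTree → ℕ
  | node cs => numEdgesList cs
/-- The number of edges of the tree whose root has the given list of child subtrees. -/
def numEdgesList : List OrderedTree → ℕ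
  | [] => 0
  | t :: ts => (numEdges t + 1) + numEdgesList ts
end

mutual
/-- The nodes of an ordered tree. A node is named by its address, the list of the (0-based)
child indices met on the path from the root to the node; the root is `[]`. -/
def nodes : OrderedTree → Finset (List ℕ)
  | node cs => {[]} ∪ nodesList 0 cs
/-- The addresses of the nodes lying in a list of sibling subtrees, where the first subtree of
the list is the child with index `i`. -/
def nodesList : ℕ → List OrderedTree → Finset (List ℕ)
  | _, [] => ∅
  | i, t :: ts => (nodes t).image (fun v => i :: v) ∪ nodesList (i + 1) ts
end

/-- The set of nodes at level `l`, i.e. at distance `l` from the root. -/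
def lev (T : OrderedTree) (l : ℕ) : Finset (List ℕ) :=
  T.nodes.filter (fun v => v.length = l)

/-- The children, from left to right and with their addresses, of a node with address `a` and
list of child subtrees `cs`. -/
def addressedChildren (a : List ℕ) (cs : List OrderedTree) : List (List ℕ × OrderedTree) :=
  cs.zipIdx.map (fun p => (a ++ [p.2], p.1))

/-- The number of nodes that are still to be visited when the given list is pending. -/
def pendingSize (q : List (List ℕ × OrderedTree)) : ℕ :=
  (q.map (fun p => p.2.numEdges + 1)).sum

theorem pendingSize_append (q r : List (List ℕ × OrderedTree)) :
    pendingSize (q ++ r) = pendingSize q + pendingSize r := by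
  simp [pendingSize]

theorem pendingSize_addressedChildren (a : List ℕ) (cs : List OrderedTree) :
    pendingSize (addressedChildren a cs) = numEdgesList cs := by
  have key : ∀ (cs : List OrderedTree) (k : ℕ),
      pendingSize ((cs.zipIdx k).map (fun p => (a ++ [p.2], p.1))) = numEdgesList cs := by
    intro cs
    induction cs with
    | nil => intro k; simp [pendingSize, numEdgesList]
    | cons t ts ih =>
      intro k
      have := ih (k + 1)
      simp only [pendingSize] at this ⊢
      simp only [List.zipIdx_cons, List.map_cons, List.sum_cons, numEdgesList, this]
  exact key cs 0

/-- Depth-first search: the pending nodes form a stack. The first pending node is visited, and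
its children are put in front of the other pending nodes. The result is the list of the
visited nodes in the order of their visits. -/
def dfsFrom : List (List ℕ × OrderedTree) → List (List ℕ)
  | [] => []
  | (a, node cs) :: q => a :: dfsFrom (addressedChildren a cs ++ q)
termination_by q => pendingSize q
decreasing_by
  rw [pendingSize_append, pendingSize_addressedChildren]
  simp [pendingSize, numEdges]

/-- Breadth-first search: the pending nodes form a queue. The first pending node is visited, and
its children are put behind the other pending nodes. The result is the list of the
visited nodes in the order of their visits. -/
def bfsFrom : List (List ℕ × OrderedTree) → List (List ℕ)
  | [] => []
  | (a, node cs) :: q => a :: bfsFrom (q ++ addressedChildren a cs)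
termination_by q => pendingSize q
decreasing_by
  rw [pendingSize_append, pendingSize_addressedChildren]
  simp [pendingSize, numEdges]
  omega

/-- The nodes of `T` in the order in which DFS, started at the root, visits them. -/
def dfsOrder (T : OrderedTree) : List (List ℕ) := dfsFrom [([], T)]

/-- The nodes of `T` in the order in which BFS, started at the root, visits them. -/
def bfsOrder (T : OrderedTree) : List (List ℕ) := bfsFrom [([], T)]

/-- The number of nodes of `T` visited before `v` by DFS. -/
def dfsScore (T : OrderedTree) (v : List ℕ) : ℕ := T.dfsOrder.idxOf v

/-- The number of nodes of `T` visited before `v` by BFS. -/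
def bfsScore (T : OrderedTree) (v : List ℕ) : ℕ := T.bfsOrder.idxOf v

theorem finite_numEdgesList_le (n : ℕ) : {cs : List OrderedTree | numEdgesList cs ≤ n}.Finite := by
  induction n with
  | zero =>
    refine (Set.finite_singleton ([] : List OrderedTree)).subset ?_
    rintro (_ | ⟨t, ts⟩) h
    · rfl
    · simp [numEdgesList] at h
  | succ n ih =>
    refine ((Set.finite_singleton ([] : List OrderedTree)).union
      (ih.image2 (fun c s => node c :: s) ih)).subset ?_
    rintro (_ | ⟨⟨c⟩, ts⟩) h
    · exact Or.inl rfl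
    · refine Or.inr ⟨c, ?_, ts, ?_, rfl⟩ <;>
      · simp only [numEdgesList, numEdges, Set.mem_ofPred_eq] at h ⊢
        omega

theorem finite_numEdges_eq (n : ℕ) : {T : OrderedTree | T.numEdges = n}.Finite := by
  refine ((finite_numEdgesList_le n).image node).subset ?_
  rintro ⟨cs⟩ h
  refine ⟨cs, ?_, rfl⟩
  simp only [numEdges, Set.mem_ofPred_eq] at h ⊢
  omega

/-- The finite set of the ordered trees with exactly `n` edges. -/
noncomputable def treesWithEdges (n : ℕ) : Finset OrderedTree := (finite_numEdges_eq n).toFinset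

/-- The sum of the BFS scores of all nodes at level `l` in the ordered trees with `n` edges. -/
noncomputable def totalB (n l : ℕ) : ℕ := ∑ T ∈ treesWithEdges n, ∑ v ∈ T.lev l, T.bfsScore v

/-- The sum of the DFS scores of all nodes at level `l` in the ordered trees with `n` edges. -/
noncomputable def totalD (n l : ℕ) : ℕ := ∑ T ∈ treesWithEdges n, ∑ v ∈ T.lev l, T.dfsScore v

/-- The possible targets: all pairs of an ordered tree with `n` edges and a node of it at
level `l`. -/
noncomputable def targets (n l : ℕ) : Finset (Σ _ : OrderedTree, List ℕ) :=
  (treesWithEdges n).sigma (fun T => T.lev l)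

/-- The mean BFS score of a uniformly random target at level `l`. -/
noncomputable def averageB (n l : ℕ) : ℝ :=
  (targets n l).expect (fun x => (x.1.bfsScore x.2 : ℝ))

/-- The mean DFS score of a uniformly random target at level `l`. -/
noncomputable def averageD (n l : ℕ) : ℝ :=
  (targets n l).expect (fun x => (x.1.dfsScore x.2 : ℝ))

/-- The real number `t` separates the levels `l < n` at which BFS is at least as good as DFS from
those at which DFS is strictly better. -/
def IsThreshold (n : ℕ) (t : ℝ) : Prop :=
  ∀ l : ℕ, l < n → (totalB n l ≤ totalD n l ↔ (l : ℝ) ≤ t)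

end OrderedTree

/-- The cumulative distribution function of the standard normal distribution. -/
noncomputable def stdNormalCDF (x : ℝ) : ℝ :=
  ProbabilityTheory.cdf (ProbabilityTheory.gaussianReal 0 1) x

/-- The function `x e^{-x²} - 2 √π (Φ(2 √2 x) - Φ(√2 x))`. -/
noncomputable def thresholdFun (x : ℝ) : ℝ :=
  x * Real.exp (-x ^ 2) - 2 * Real.sqrt Real.pi *
    (stdNormalCDF (2 * Real.sqrt 2 * x) - stdNormalCDF (Real.sqrt 2 * x))

-- The DFS order is pre-order, and the BFS order lists the same nodes sorted by level. Hence the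
-- total of the scores at a level depends only on the sequence of levels: for BFS only on the level
-- widths, for DFS through a recursion that splits off the leftmost child subtree of the root.
--
-- Let C and N be the generating functions of trees and of trees with a marked node, and let z = X
-- C². Splitting a tree at its leftmost child gives C z^l for widths, l N z^l for DFS sums, and a
-- combination of terms N z^m for products of two widths (`gf_width`, `gf_dfsSum`,
-- `gf_width_mul_width`). Since N z^m has coefficients b(m) = binom(2n, n+m)
-- (`coeff_nodeGf_mul_stepGf_pow`), both totals have closed forms, and BFS is at least as good as
-- DFS at a level 1 ≤ l < n exactly when the mean over l ≤ k < 2l of (b(k+1) + b(k+2)) / b(l+1) is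
-- at least 1.
--
-- Log-concavity of b makes this mean nonincreasing in l (`meanRatio_succ_le`), so a threshold
-- exists. For l ~ x√n the mean tends to ∫ 2 exp(-x²(s²-1)) ds over 1 ≤ s ≤ 2 (`tendsto_meanRatio`),
-- which is strictly decreasing in x ≥ 0. The threshold function is x exp(-x²) times 1 minus this
-- integral (`thresholdFun_eq`). Its positive root is therefore unique; Taylor bounds locate it, and
-- comparison at levels ⌊c√n⌋ with c near the root gives the asymptotics.

namespace OrderedTree

-- Pre-order and the two search orders.

/-- The first-child/next-sibling view of a forest gives a binary recursion on one type, which avoids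
the nested induction on trees and lists of trees. -/
theorem forest_induction {Q : List OrderedTree → Prop} (nil : Q [])
    (cons : ∀ c ts, Q c → Q ts → Q (node c :: ts)) (cs : List OrderedTree) : Q cs := by
  induction h : numEdgesList cs using Nat.strong_induction_on generalizing cs with
  | _ n ih =>
    match cs, h with
    | [], _ => exact nil
    | node c :: ts, h =>
      simp only [numEdgesList, numEdges] at h
      exact cons c ts (ih _ (by omega) c rfl) (ih _ (by omega) ts rfl)

mutual
/-- The addresses of the nodes of an ordered tree in pre-order. -/
def preorder : OrderedTree → List (List ℕ)
  | node cs => [] :: preorderList 0 cs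
/-- The addresses of the nodes of a list of sibling subtrees in pre-order, where the first subtree
of the list is the child with index `i`. -/
def preorderList : ℕ → List OrderedTree → List (List ℕ)
  | _, [] => []
  | i, t :: ts => (preorder t).map (fun v => i :: v) ++ preorderList (i + 1) ts
end

theorem mem_preorderList (cs : List OrderedTree) :
    ∀ (i : ℕ) (v : List ℕ), v ∈ preorderList i cs ↔ v ∈ nodesList i cs := by
  induction cs using forest_induction with
  | nil => simp [preorderList, nodesList]
  | cons c ts hc hts => intro i v; simp [preorderList, nodesList, preorder, nodes, hc, hts]

theorem toFinset_preorder (T : OrderedTree) : T.preorder.toFinset = T.nodes := by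
  obtain ⟨cs⟩ := T
  ext v
  simp [preorder, nodes, mem_preorderList]

theorem nodup_preorderList (cs : List OrderedTree) :
    ∀ i : ℕ, (preorderList i cs).Nodup ∧
      ∀ v ∈ preorderList i cs, ∃ j w, v = j :: w ∧ i ≤ j := by
  induction cs using forest_induction with
  | nil => simp [preorderList]
  | cons c ts hc hts =>
    intro i
    simp only [preorderList, preorder, List.nodup_append, List.mem_append]
    refine ⟨⟨?_, (hts _).1, ?_⟩, ?_⟩
    · refine List.Nodup.map (fun a b h => by simpa using h) (List.nodup_cons.2 ⟨?_, (hc 0).1⟩)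
      intro h
      obtain ⟨j, w, h, -⟩ := (hc 0).2 _ h
      simp at h
    · intro a ha b hb hab
      obtain ⟨j, w, h, hj⟩ := (hts (i + 1)).2 _ hb
      rw [List.mem_map] at ha
      obtain ⟨x, -, rfl⟩ := ha
      rw [h] at hab
      simp at hab
      omega
    · rintro v (hv | hv)
      · rw [List.mem_map] at hv
        obtain ⟨x, -, rfl⟩ := hv
        exact ⟨_, _, rfl, le_rfl⟩
      · obtain ⟨j, w, h, hj⟩ := (hts (i + 1)).2 _ hv
        exact ⟨j, w, h, by omega⟩

theorem nodup_preorder (T : OrderedTree) : T.preorder.Nodup := by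
  obtain ⟨cs⟩ := T
  refine List.nodup_cons.2 ⟨fun h => ?_, (nodup_preorderList cs 0).1⟩
  obtain ⟨j, w, h, -⟩ := (nodup_preorderList cs 0).2 _ h
  simp at h

/-- The pre-order traversals of the pending subtrees, one after the other. -/
def pendingPreorder (q : List (List ℕ × OrderedTree)) : List (List ℕ) :=
  q.flatMap (fun p => p.2.preorder.map (fun v => p.1 ++ v))

theorem pendingPreorder_addressedChildren (a : List ℕ) (cs : List OrderedTree) :
    pendingPreorder (addressedChildren a cs) = (preorderList 0 cs).map (fun v => a ++ v) := by
  have key : ∀ (cs : List OrderedTree) (k : ℕ),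
      pendingPreorder ((cs.zipIdx k).map (fun p => (a ++ [p.2], p.1))) =
        (preorderList k cs).map (fun v => a ++ v) := by
    intro cs
    induction cs with
    | nil => simp [pendingPreorder, preorderList]
    | cons t ts ih =>
      intro k
      have := ih (k + 1)
      simp only [pendingPreorder] at this ⊢
      simp [List.zipIdx_cons, preorderList, this]
  exact key cs 0

theorem dfsFrom_eq (q : List (List ℕ × OrderedTree)) : dfsFrom q = pendingPreorder q := by
  induction q using dfsFrom.induct with
  | case1 => simp [dfsFrom, pendingPreorder]
  | case2 a cs q ih =>
    have h := pendingPreorder_addressedChildren a cs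
    rw [dfsFrom, ih]
    simp only [pendingPreorder] at h ⊢
    simp [h, preorder]

theorem dfsOrder_eq (T : OrderedTree) : T.dfsOrder = T.preorder := by
  simp [dfsOrder, dfsFrom_eq, pendingPreorder]

/-- Putting the children behind the queue instead of in front of it only permutes the pending
pre-orders. -/
theorem bfsFrom_perm (q : List (List ℕ × OrderedTree)) :
    (bfsFrom q).Perm (pendingPreorder q) := by
  induction q using bfsFrom.induct with
  | case1 => simp [bfsFrom, pendingPreorder]
  | case2 a cs q ih =>
    have h := pendingPreorder_addressedChildren a cs
    rw [bfsFrom]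
    simp only [pendingPreorder] at h ih ⊢
    rw [List.flatMap_append, h] at ih
    refine (ih.trans List.perm_append_comm).cons a |>.trans ?_
    simp [preorder]

theorem bfsOrder_perm (T : OrderedTree) : T.bfsOrder.Perm T.preorder := by
  simpa [bfsOrder, pendingPreorder] using bfsFrom_perm [([], T)]

/-- This is the queue invariant: pending levels are nondecreasing and take at most the two values
`h` and `h + 1`, so the children of the head, one level below it, can go to the end. -/
theorem bfsFrom_sorted (q : List (List ℕ × OrderedTree)) (h : ℕ)
    (hq : (q.map (fun p => p.1.length)).Pairwise (· ≤ ·))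
    (hh : ∀ p ∈ q, h ≤ p.1.length ∧ p.1.length ≤ h + 1) :
    ((bfsFrom q).map List.length).Pairwise (· ≤ ·) ∧ ∀ v ∈ bfsFrom q, h ≤ v.length := by
  induction q using bfsFrom.induct generalizing h with
  | case1 => simp [bfsFrom]
  | case2 a cs q ih =>
    have hch : ∀ p ∈ addressedChildren a cs, p.1.length = a.length + 1 := by
      intro p hp
      simp only [addressedChildren, List.mem_map] at hp
      obtain ⟨x, -, rfl⟩ := hp
      simp
    have ha := hh (a, node cs) (by simp)
    simp only [List.map_cons, List.pairwise_cons, List.mem_map, forall_exists_index, and_imp,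
      forall_apply_eq_imp_iff₂] at hq
    have hq' : ∀ p ∈ q, a.length ≤ p.1.length ∧ p.1.length ≤ a.length + 1 := fun p hp =>
      ⟨hq.1 p hp, by have := hh p (by simp [hp]); simp only at ha; omega⟩
    obtain ⟨h1, h2⟩ := ih a.length (by
      rw [List.map_append, List.pairwise_append]
      refine ⟨hq.2, ?_, ?_⟩
      · rw [List.pairwise_map, List.pairwise_iff_forall_sublist]
        intro x y hxy
        rw [hch x (hxy.subset (by simp)), hch y (hxy.subset (by simp))]
      · simp only [List.mem_map]
        rintro _ ⟨x, hx, rfl⟩ _ ⟨y, hy, rfl⟩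
        rw [hch y hy]
        exact (hq' x hx).2) (by
      intro p hp
      rcases List.mem_append.1 hp with hp | hp
      · exact hq' p hp
      · simp [hch p hp])
    rw [bfsFrom]
    refine ⟨?_, ?_⟩
    · simp only [List.map_cons, List.pairwise_cons]
      refine ⟨?_, h1⟩
      simp only [List.mem_map]
      rintro _ ⟨x, hx, rfl⟩
      exact h2 x hx
    · intro v hv
      rcases List.mem_cons.1 hv with rfl | hv
      · exact ha.1
      · exact ha.1.trans (h2 v hv)

theorem bfsOrder_sorted (T : OrderedTree) : (T.bfsOrder.map List.length).Pairwise (· ≤ ·) :=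
  (bfsFrom_sorted [([], T)] 0 (by simp) (by simp)).1

-- Sums of positions in a sequence of levels.

/-- The sum of the (0-based) positions of the entries `l` of a list. -/
def posSum (l : ℕ) : List ℕ → ℕ
  | [] => 0
  | _ :: L => posSum l L + L.count l

theorem posSum_append (l : ℕ) (L M : List ℕ) :
    posSum l (L ++ M) = posSum l L + L.length * M.count l + posSum l M := by
  induction L with
  | nil => simp [posSum]
  | cons a L ih =>
    simp only [List.cons_append, posSum, ih, List.count_append, List.length_cons]
    ring

theorem posSum_map_succ (l : ℕ) (L : List ℕ) :
    posSum (l + 1) (L.map Nat.succ) = posSum l L := by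
  induction L with
  | nil => rfl
  | cons a L ih =>
    simp only [List.map_cons, posSum, ih]
    rw [← List.count_map_of_injective L _ Nat.succ_injective l]

theorem posSum_zero_map_succ (L : List ℕ) : posSum 0 (L.map Nat.succ) = 0 := by
  induction L with
  | nil => rfl
  | cons a L ih =>
    simp only [List.map_cons, posSum, ih, List.count_eq_zero, zero_add]
    simp

/-- In a sorted list the entries `l` form one block, which starts after all smaller entries; the
offsets 0, 1, 2, ... within the block add up to the binomial coefficient. -/
theorem posSum_of_sorted (l : ℕ) (L : List ℕ) (hL : L.Pairwise (· ≤ ·)) :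
    posSum l L = (∑ k ∈ Finset.range l, L.count k) * L.count l + (L.count l).choose 2 := by
  induction L with
  | nil => simp [posSum]
  | cons a L ih =>
    rw [List.pairwise_cons] at hL
    rw [posSum, ih hL.2]
    rcases lt_trichotomy a l with h | h | h
    · have : ∑ k ∈ Finset.range l, (a :: L).count k = ∑ k ∈ Finset.range l, L.count k + 1 := by
        simp only [List.count_cons, Finset.sum_add_distrib]
        simp [h]
      rw [this, List.count_cons_of_ne h.ne]
      ring
    · subst h
      have h0 : ∀ k ∈ Finset.range a, L.count k = 0 := by
        intro k hk
        rw [List.count_eq_zero]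
        intro hkL
        have := hL.1 k hkL
        have := Finset.mem_range.1 hk
        omega
      have h1 : ∀ k ∈ Finset.range a, (a :: L).count k = 0 := by
        intro k hk
        rw [List.count_cons_of_ne (by have := Finset.mem_range.1 hk; omega), h0 k hk]
      rw [Finset.sum_eq_zero h0, Finset.sum_eq_zero h1, List.count_cons_self,
        Nat.choose_succ_succ' _ 1]
      simp [add_comm]
    · have h0 : L.count l = 0 := by
        rw [List.count_eq_zero]
        intro hl
        have := hL.1 l hl
        omega
      rw [List.count_cons_of_ne h.ne', h0]
      simp

theorem count_map_length (L : List (List ℕ)) (hL : L.Nodup) (l : ℕ) :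
    (L.map List.length).count l = (L.toFinset.filter (fun v => v.length = l)).card := by
  have h : L.toFinset.filter (fun v => v.length = l) =
      (L.filter (fun v => decide (v.length = l))).toFinset := by
    ext v
    simp
  rw [h, List.toFinset_card_of_nodup (hL.filter _), List.count, List.countP_map,
    List.countP_eq_length_filter]
  congr 1

/-- From here on addresses can be forgotten: only the sequence of levels matters. -/
theorem sum_idxOf_eq_posSum (L : List (List ℕ)) (hL : L.Nodup) (l : ℕ) :
    ∑ v ∈ L.toFinset.filter (fun v => v.length = l), L.idxOf v =
      posSum l (L.map List.length) := by
  induction L with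
  | nil => simp [posSum]
  | cons a L ih =>
    rw [List.nodup_cons] at hL
    have hcard := count_map_length L hL.2 l
    have hs : ∑ v ∈ L.toFinset.filter (fun v => v.length = l), (a :: L).idxOf v =
        posSum l (L.map List.length) + (L.map List.length).count l := by
      rw [hcard, ← ih hL.2, Finset.card_eq_sum_ones, ← Finset.sum_add_distrib]
      refine Finset.sum_congr rfl fun v hv => ?_
      rw [List.idxOf_cons_ne]
      rintro rfl
      simp at hv
      exact hL.1 hv.1
    rw [List.map_cons, posSum, ← hs, List.toFinset_cons, Finset.filter_insert]
    split_ifs with h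
    · rw [Finset.sum_insert (by simp [hL.1])]
      simp
    · rfl

-- Recursions for level widths and DFS sums.

/-- The levels of the nodes of a tree, listed in pre-order. -/
def levels (T : OrderedTree) : List ℕ := T.preorder.map List.length

theorem levels_nil : levels (node []) = [0] := by
  simp [levels, preorder, preorderList]

theorem map_length_preorderList (cs : List OrderedTree) (i j : ℕ) :
    (preorderList i cs).map List.length = (preorderList j cs).map List.length := by
  induction cs generalizing i j with
  | nil => rfl
  | cons t ts ih =>
    simp only [preorderList, List.map_append, List.map_map]
    rw [ih (i + 1) (j + 1)]
    rfl

theorem levels_cons (t : OrderedTree) (ts : List OrderedTree) :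
    levels (node (t :: ts)) = 0 :: ((levels t).map Nat.succ ++ (levels (node ts)).tail) := by
  simp only [levels, preorder, preorderList, List.map_cons, List.map_append, List.map_map,
    List.tail_cons, List.length_nil]
  rw [map_length_preorderList ts (0 + 1) 0]
  rfl

theorem levels_eq_cons (cs : List OrderedTree) :
    ∃ L : List ℕ, levels (node cs) = 0 :: L.map Nat.succ := by
  induction cs with
  | nil => exact ⟨[], levels_nil⟩
  | cons t ts ih =>
    obtain ⟨L, hL⟩ := ih
    exact ⟨levels t ++ L, by simp [levels_cons, hL]⟩

/-- The number of nodes at level `l`. -/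
def width (l : ℕ) (T : OrderedTree) : ℕ := T.levels.count l

/-- The sum of the positions in pre-order of the nodes at level `l`. -/
def dfsSum (l : ℕ) (T : OrderedTree) : ℕ := posSum l T.levels

theorem width_zero (T : OrderedTree) : width 0 T = 1 := by
  obtain ⟨cs⟩ := T
  obtain ⟨L, hL⟩ := levels_eq_cons cs
  simp [width, hL, List.count_eq_zero]

theorem width_succ_nil (l : ℕ) : width (l + 1) (node []) = 0 := by
  simp [width, levels_nil]

theorem width_succ_cons (l : ℕ) (t : OrderedTree) (ts : List OrderedTree) :
    width (l + 1) (node (t :: ts)) = width l t + width (l + 1) (node ts) := by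
  obtain ⟨L, hL⟩ := levels_eq_cons ts
  simp only [width, levels_cons, hL, List.tail_cons]
  rw [List.count_cons_of_ne (by omega), List.count_cons_of_ne (by omega), List.count_append]
  congr 1
  exact List.count_map_of_injective _ _ Nat.succ_injective l

theorem numEdgesList_eq (cs : List OrderedTree) :
    ∀ i : ℕ, (preorderList i cs).length = numEdgesList cs := by
  induction cs using forest_induction with
  | nil => simp [preorderList, numEdgesList]
  | cons c ts hc hts =>
    intro i
    simp [preorderList, preorder, numEdgesList, numEdges, hc, hts]
    omega

theorem length_levels (T : OrderedTree) : T.levels.length = T.numEdges + 1 := by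
  obtain ⟨cs⟩ := T
  simp [levels, preorder, numEdgesList_eq, numEdges]

theorem dfsSum_zero (T : OrderedTree) : dfsSum 0 T = 0 := by
  obtain ⟨cs⟩ := T
  obtain ⟨L, hL⟩ := levels_eq_cons cs
  simp [dfsSum, hL, posSum, posSum_zero_map_succ, List.count_eq_zero]

theorem dfsSum_nil (l : ℕ) : dfsSum l (node []) = 0 := by
  simp [dfsSum, levels_nil, posSum]

/-- Nodes of `t` are delayed by the root alone; nodes of the remaining subtrees are delayed by all
nodes of `t`. -/
theorem dfsSum_succ_cons (l : ℕ) (t : OrderedTree) (ts : List OrderedTree) :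
    dfsSum (l + 1) (node (t :: ts)) =
      dfsSum l t + width l t + (t.numEdges + 1) * width (l + 1) (node ts) +
        dfsSum (l + 1) (node ts) := by
  obtain ⟨L, hL⟩ := levels_eq_cons ts
  have h := List.count_map_of_injective t.levels _ Nat.succ_injective l
  simp only [dfsSum, width, levels_cons, hL, List.tail_cons, posSum, posSum_append,
    posSum_map_succ, List.count_append, List.length_map, length_levels]
  rw [h, List.count_cons_of_ne (by omega)]
  ring

theorem card_lev (T : OrderedTree) (l : ℕ) : (T.lev l).card = width l T := by
  rw [lev, ← toFinset_preorder, ← count_map_length _ T.nodup_preorder, width, levels]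

theorem sum_dfsScore (T : OrderedTree) (l : ℕ) :
    ∑ v ∈ T.lev l, T.dfsScore v = dfsSum l T := by
  simp only [dfsScore, dfsOrder_eq, lev, ← toFinset_preorder, dfsSum, levels]
  exact sum_idxOf_eq_posSum _ T.nodup_preorder l

theorem sum_bfsScore (T : OrderedTree) (l : ℕ) :
    ∑ v ∈ T.lev l, T.bfsScore v =
      (∑ k ∈ Finset.range l, width k T) * width l T + (width l T).choose 2 := by
  have hp := T.bfsOrder_perm
  have hf : T.bfsOrder.toFinset = T.nodes := by
    rw [← toFinset_preorder]
    exact List.toFinset_eq_of_perm _ _ hp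
  have hc : ∀ k, (T.bfsOrder.map List.length).count k = width k T := fun k =>
    (hp.map List.length).count_eq k
  simp only [bfsScore, lev, ← hf]
  rw [sum_idxOf_eq_posSum _ (hp.nodup_iff.2 T.nodup_preorder) l,
    posSum_of_sorted l _ T.bfsOrder_sorted]
  simp only [hc]

end OrderedTree

-- Generating functions by number of edges.

namespace OrderedTree

open PowerSeries

theorem mem_treesWithEdges (n : ℕ) (T : OrderedTree) :
    T ∈ treesWithEdges n ↔ T.numEdges = n := by
  simp [treesWithEdges]

/-- The tree obtained by adding the tree `t` as the leftmost child subtree of the root. -/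
def graft (t : OrderedTree) : OrderedTree → OrderedTree
  | node ts => node (t :: ts)

theorem numEdges_graft (t u : OrderedTree) :
    (graft t u).numEdges = t.numEdges + u.numEdges + 1 := by
  obtain ⟨ts⟩ := u
  simp only [graft, numEdges, numEdgesList]
  omega

theorem graft_injective2 {t t' u u' : OrderedTree} (h : graft t u = graft t' u') :
    t = t' ∧ u = u' := by
  obtain ⟨ts⟩ := u
  obtain ⟨ts'⟩ := u'
  simpa [graft] using h

theorem treesWithEdges_zero : treesWithEdges 0 = {node []} := by
  ext T
  rw [mem_treesWithEdges, Finset.mem_singleton]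
  obtain ⟨_ | ⟨t, ts⟩⟩ := T <;> simp [numEdges, numEdgesList]

/-- A tree with at least one edge is uniquely a graft, and the grafting edge accounts for the drop
from `n + 1` to `n`. -/
theorem sum_treesWithEdges_succ (n : ℕ) (s : OrderedTree → ℤ) :
    ∑ T ∈ treesWithEdges (n + 1), s T =
      ∑ p ∈ Finset.HasAntidiagonal.antidiagonal n, ∑ t ∈ treesWithEdges p.1, ∑ u ∈ treesWithEdges p.2,
        s (graft t u) := by
  simp_rw [← Finset.sum_product']
  rw [Finset.sum_sigma' (Finset.HasAntidiagonal.antidiagonal n)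
    (fun p => treesWithEdges p.1 ×ˢ treesWithEdges p.2) (fun _ x => s (graft x.1 x.2))]
  symm
  refine Finset.sum_bij (fun x _ => graft x.2.1 x.2.2) ?_ ?_ ?_ ?_
  · rintro ⟨p, t, u⟩ h
    simp only [Finset.mem_sigma, Finset.HasAntidiagonal.mem_antidiagonal, Finset.mem_product,
      mem_treesWithEdges] at h
    rw [mem_treesWithEdges, numEdges_graft]
    simp only
    omega
  · rintro ⟨⟨i, j⟩, t, u⟩ h ⟨⟨i', j'⟩, t', u'⟩ h' heq
    simp only [Finset.mem_sigma, Finset.HasAntidiagonal.mem_antidiagonal, Finset.mem_product,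
      mem_treesWithEdges] at h h'
    obtain ⟨rfl, rfl⟩ := graft_injective2 heq
    obtain ⟨-, rfl, rfl⟩ := h
    obtain ⟨-, rfl, rfl⟩ := h'
    rfl
  · rintro ⟨_ | ⟨t, ts⟩⟩ hT
    · rw [mem_treesWithEdges] at hT
      simp [numEdges, numEdgesList] at hT
    · rw [mem_treesWithEdges] at hT
      have := numEdges_graft t (node ts)
      simp only [graft] at this
      refine ⟨⟨(t.numEdges, (node ts).numEdges), t, node ts⟩, ?_, rfl⟩
      simp only [Finset.mem_sigma, Finset.HasAntidiagonal.mem_antidiagonal, Finset.mem_product,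
        mem_treesWithEdges, and_self, and_true]
      omega
  · rintro ⟨p, t, u⟩ _
    rfl

/-- The generating function of a statistic of ordered trees, by number of edges. -/
noncomputable def gf (s : OrderedTree → ℤ) : PowerSeries ℤ :=
  PowerSeries.mk fun n => ∑ T ∈ treesWithEdges n, s T

/-- The generating function of a statistic of pairs of ordered trees, by number of edges. -/
noncomputable def pairGf (f : OrderedTree → OrderedTree → ℤ) : PowerSeries ℤ :=
  PowerSeries.mk fun n => ∑ p ∈ Finset.HasAntidiagonal.antidiagonal n, ∑ t ∈ treesWithEdges p.1,
    ∑ u ∈ treesWithEdges p.2, f t u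

theorem gf_eq (s : OrderedTree → ℤ) :
    gf s = C (s (node [])) + X * pairGf (fun t u => s (graft t u)) := by
  ext n
  cases n with
  | zero => simp [gf, treesWithEdges_zero]
  | succ n =>
    rw [map_add, coeff_succ_X_mul, coeff_C, if_neg n.succ_ne_zero, zero_add, gf, pairGf, coeff_mk,
      coeff_mk, sum_treesWithEdges_succ]

theorem pairGf_add (f g : OrderedTree → OrderedTree → ℤ) :
    pairGf (fun t u => f t u + g t u) = pairGf f + pairGf g := by
  ext n
  simp [pairGf, Finset.sum_add_distrib]

theorem pairGf_mul (f g : OrderedTree → ℤ) :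
    pairGf (fun t u => f t * g u) = gf f * gf g := by
  ext n
  simp [pairGf, gf, coeff_mul, Finset.sum_mul_sum]

/-- The generating function of the ordered trees. -/
noncomputable def treeGf : PowerSeries ℤ := gf fun _ => 1

/-- The generating function of the pairs of an ordered tree and one of its nodes. -/
noncomputable def nodeGf : PowerSeries ℤ := gf fun T => T.numEdges + 1

/-- The series `X * treeGf ^ 2`. -/
noncomputable def stepGf : PowerSeries ℤ := X * treeGf ^ 2

theorem treeGf_eq : treeGf = 1 + stepGf := by
  have h := gf_eq fun _ => 1
  have h2 := pairGf_mul (fun _ => 1) (fun _ => 1)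
  simp only [mul_one] at h2
  rw [h2, ← treeGf] at h
  rw [stepGf]
  refine h.trans ?_
  simp only [map_one]
  ring

theorem nodeGf_eq : nodeGf = 1 + 2 * X * nodeGf * treeGf := by
  have h := gf_eq fun T => (T.numEdges : ℤ) + 1
  have h2 : (fun t u : OrderedTree => ((graft t u).numEdges : ℤ) + 1) =
      fun t u => ((t.numEdges : ℤ) + 1) * 1 + 1 * ((u.numEdges : ℤ) + 1) := by
    ext t u
    rw [numEdges_graft]
    push_cast
    ring
  rw [h2, pairGf_add, pairGf_mul (fun t => (t.numEdges : ℤ) + 1) (fun _ => 1),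
    pairGf_mul (fun _ => 1) (fun t => (t.numEdges : ℤ) + 1), ← treeGf, ← nodeGf] at h
  simp only [numEdges, numEdgesList, Nat.cast_zero, zero_add, map_one] at h
  refine h.trans ?_
  ring

theorem treeGf_eq_nodeGf_mul : treeGf = nodeGf * (1 - stepGf) := by
  have h1 := treeGf_eq
  have h2 := nodeGf_eq
  rw [stepGf] at *
  have h3 : nodeGf * (1 - 2 * X * treeGf) = 1 := by linear_combination h2
  linear_combination nodeGf * h1 - treeGf * h3

/-- The equation C = 1 + X C² says that C is the inverse of 1 - X C. This solves every linear
recursion in which the statistic of the rest of the tree reappears. -/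
theorem eq_of_eq_X_mul_add {A F : PowerSeries ℤ} (h : F = X * (A + treeGf * F)) :
    F = X * treeGf * A := by
  have h1 := treeGf_eq
  rw [stepGf] at h1
  linear_combination treeGf * h - F * h1

theorem gf_width (l : ℕ) : gf (fun T => width l T) = treeGf * stepGf ^ l := by
  induction l with
  | zero => simp [width_zero, treeGf]
  | succ l ih =>
    have h := gf_eq fun T => (width (l + 1) T : ℤ)
    have h2 : (fun t u : OrderedTree => (width (l + 1) (graft t u) : ℤ)) =
        fun t u => (width l t : ℤ) * 1 + 1 * (width (l + 1) u : ℤ) := by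
      ext t ⟨ts⟩
      rw [graft, width_succ_cons]
      push_cast
      ring
    rw [h2, pairGf_add, pairGf_mul (fun t => (width l t : ℤ)) (fun _ => 1),
      pairGf_mul (fun _ => 1) (fun t => (width (l + 1) t : ℤ)), ← treeGf, width_succ_nil,
      Nat.cast_zero, map_zero, zero_add] at h
    rw [eq_of_eq_X_mul_add h, ih, stepGf]
    ring

theorem gf_dfsSum (l : ℕ) :
    gf (fun T => dfsSum l T) = (l : PowerSeries ℤ) * (nodeGf * stepGf ^ l) := by
  induction l with
  | zero =>
    ext n
    simp [dfsSum_zero, gf]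
  | succ l ih =>
    have h := gf_eq fun T => (dfsSum (l + 1) T : ℤ)
    have h2 : (fun t u : OrderedTree => (dfsSum (l + 1) (graft t u) : ℤ)) =
        fun t u => (((dfsSum l t : ℤ) * 1 + (width l t : ℤ) * 1) +
          ((t.numEdges : ℤ) + 1) * (width (l + 1) u : ℤ)) + 1 * (dfsSum (l + 1) u : ℤ) := by
      ext t ⟨ts⟩
      rw [graft, dfsSum_succ_cons]
      push_cast
      ring
    rw [h2, pairGf_add, pairGf_add, pairGf_add,
      pairGf_mul (fun t => (dfsSum l t : ℤ)) (fun _ => 1),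
      pairGf_mul (fun t => (width l t : ℤ)) (fun _ => 1),
      pairGf_mul (fun t => (t.numEdges : ℤ) + 1) (fun t => (width (l + 1) t : ℤ)),
      pairGf_mul (fun _ => 1) (fun t => (dfsSum (l + 1) t : ℤ)), ← treeGf, ← nodeGf,
      dfsSum_nil, Nat.cast_zero, map_zero, zero_add] at h
    rw [eq_of_eq_X_mul_add h, ih, gf_width, gf_width]
    have h1 := treeGf_eq_nodeGf_mul
    have hs : X * treeGf ^ 2 = stepGf := rfl
    push_cast
    linear_combination (stepGf ^ (l + 1)) * h1 +
      (l * nodeGf * stepGf ^ l + stepGf ^ l * treeGf + nodeGf * stepGf ^ (l + 1)) * hs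

/-- Passing to the leftmost subtree lowers both levels by one, so the gap `d` stays fixed in the
induction on `k`. The cross terms, with the two nodes in different parts of the graft, are products
of width series; C = N(1 - z) brings everything to the form N z^m. -/
theorem gf_width_mul_width (k d : ℕ) :
    gf (fun T => width k T * width (k + d) T) =
      nodeGf * stepGf ^ (k + d) + nodeGf * stepGf ^ (k + d + 1)
        - 2 * (nodeGf * stepGf ^ (2 * k + d + 1)) := by
  induction k with
  | zero =>
    simp only [width_zero, Nat.cast_one, one_mul, zero_add, gf_width]
    linear_combination stepGf ^ d * treeGf_eq_nodeGf_mul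
  | succ k ih =>
    have e : k + 1 + d = k + d + 1 := by omega
    rw [e]
    have h := gf_eq fun T => (width (k + 1) T : ℤ) * width (k + d + 1) T
    have h2 : (fun t u : OrderedTree =>
          (width (k + 1) (graft t u) : ℤ) * width (k + d + 1) (graft t u)) =
        fun t u => (((width k t : ℤ) * width (k + d) t) * 1 +
          (width k t : ℤ) * (width (k + d + 1) u : ℤ) +
          (width (k + d) t : ℤ) * (width (k + 1) u : ℤ)) +
          1 * ((width (k + 1) u : ℤ) * width (k + d + 1) u) := by
      ext t ⟨ts⟩
      rw [graft, width_succ_cons, width_succ_cons]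
      push_cast
      ring
    rw [h2, pairGf_add, pairGf_add, pairGf_add,
      pairGf_mul (fun t => (width k t : ℤ) * width (k + d) t) (fun _ => 1),
      pairGf_mul (fun t => (width k t : ℤ)) (fun t => (width (k + d + 1) t : ℤ)),
      pairGf_mul (fun t => (width (k + d) t : ℤ)) (fun t => (width (k + 1) t : ℤ)),
      pairGf_mul (fun _ => 1) (fun t => (width (k + 1) t : ℤ) * width (k + d + 1) t), ← treeGf,
      width_succ_nil, Nat.cast_zero, zero_mul, map_zero, zero_add] at h
    rw [eq_of_eq_X_mul_add h, ih, gf_width, gf_width, gf_width, gf_width]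
    have h1 := treeGf_eq_nodeGf_mul
    have hs : X * treeGf ^ 2 = stepGf := rfl
    linear_combination (2 * stepGf ^ (2 * k + d + 2)) * h1 +
      (nodeGf * stepGf ^ (k + d) + nodeGf * stepGf ^ (k + d + 1)
        - 2 * (nodeGf * stepGf ^ (2 * k + d + 1)) + 2 * treeGf * stepGf ^ (2 * k + d + 1)) * hs

end OrderedTree

-- Binomial coefficients and closed forms of the totals.

/-- The binomial coefficient `2 n` over `n - m`, which is `0` for `n < m`. -/
def offCentral (n m : ℕ) : ℕ := (2 * n).choose (n + m)

theorem offCentral_succ_succ (n m : ℕ) :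
    offCentral (n + 1) (m + 1) =
      offCentral n m + 2 * offCentral n (m + 1) + offCentral n (m + 2) := by
  simp only [offCentral]
  rw [show 2 * (n + 1) = 2 * n + 1 + 1 by ring, show n + 1 + (m + 1) = n + m + 1 + 1 by ring,
    Nat.choose_succ_succ, Nat.choose_succ_succ, Nat.choose_succ_succ (2 * n) (n + m + 1),
    show n + (m + 1) = n + m + 1 by ring, show n + (m + 2) = n + m + 1 + 1 by ring]
  simp only [Nat.succ_eq_add_one]
  ring

theorem offCentral_succ_zero (n : ℕ) :
    offCentral (n + 1) 0 = 2 * offCentral n 0 + 2 * offCentral n 1 := by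
  simp only [offCentral, add_zero]
  -- The two middle entries of row `2 * n + 1` are equal.
  rw [show 2 * (n + 1) = 2 * n + 1 + 1 by ring, Nat.choose_succ_succ,
    ← Nat.choose_symm_half, Nat.choose_succ_succ]
  simp only [Nat.succ_eq_add_one]
  ring

theorem offCentral_eq_zero {n m : ℕ} (h : n < m) : offCentral n m = 0 :=
  Nat.choose_eq_zero_of_lt (by omega)

theorem offCentral_pos {n m : ℕ} (h : m ≤ n) : 0 < offCentral n m :=
  Nat.choose_pos (by omega)

theorem offCentral_succ_mul (n m : ℕ) :
    offCentral n (m + 1) * (n + m + 1) = offCentral n m * (n - m) := by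
  have := Nat.choose_succ_right_eq (2 * n) (n + m)
  rw [show 2 * n - (n + m) = n - m by omega] at this
  exact this

namespace OrderedTree

open PowerSeries

/-- As z = X(1 + z)², the series satisfy N z^(m+1) = X N z^m (1 + z)², which is Pascal's rule
applied twice; at exponent 0 the recursion is N = 1 + 2X N(1 + z). -/
theorem coeff_nodeGf_mul_stepGf_pow (n m : ℕ) :
    coeff n (nodeGf * stepGf ^ m) = offCentral n m := by
  induction n generalizing m with
  | zero =>
    cases m with
    | zero =>
      have h := congrArg (coeff 0) nodeGf_eq
      rw [pow_zero, mul_one, h]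
      simp [offCentral, mul_assoc]
    | succ m => simp [stepGf, offCentral, pow_succ]
  | succ n ih =>
    have h1 := treeGf_eq
    have h2 := nodeGf_eq
    have hs : X * treeGf ^ 2 = stepGf := rfl
    cases m with
    | zero =>
      have h : nodeGf * stepGf ^ 0 =
          1 + X * (nodeGf * stepGf ^ 0 + nodeGf * stepGf ^ 0 + (nodeGf * stepGf ^ 1 +
            nodeGf * stepGf ^ 1)) := by
        linear_combination h2 + 2 * X * nodeGf * h1
      rw [h]
      simp only [map_add, coeff_succ_X_mul, ih, offCentral_succ_zero, coeff_one]
      push_cast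
      simp
      ring
    | succ m =>
      have h : nodeGf * stepGf ^ (m + 1) =
          X * (nodeGf * stepGf ^ m + (nodeGf * stepGf ^ (m + 1) + nodeGf * stepGf ^ (m + 1)) +
            nodeGf * stepGf ^ (m + 2)) := by
        linear_combination -(nodeGf * stepGf ^ m) * hs +
          X * nodeGf * stepGf ^ m * (treeGf + 1 + stepGf) * h1
      rw [h]
      simp only [map_add, coeff_succ_X_mul, ih, offCentral_succ_succ]
      push_cast
      ring

theorem sum_width (n l : ℕ) :
    (∑ T ∈ treesWithEdges n, (width l T : ℤ)) = offCentral n l - offCentral n (l + 1) := by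
  have h := congrArg (coeff n) (gf_width l)
  rw [treeGf_eq_nodeGf_mul, show nodeGf * (1 - stepGf) * stepGf ^ l =
    nodeGf * stepGf ^ l - nodeGf * stepGf ^ (l + 1) by ring, map_sub,
    coeff_nodeGf_mul_stepGf_pow, coeff_nodeGf_mul_stepGf_pow, gf, coeff_mk] at h
  exact h

theorem sum_width_mul_width (n k d : ℕ) :
    (∑ T ∈ treesWithEdges n, (width k T : ℤ) * width (k + d) T) =
      offCentral n (k + d) + offCentral n (k + d + 1) - 2 * offCentral n (2 * k + d + 1) := by
  have h := congrArg (coeff n) (gf_width_mul_width k d)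
  rw [two_mul (nodeGf * _), map_sub, map_add, map_add, coeff_nodeGf_mul_stepGf_pow,
    coeff_nodeGf_mul_stepGf_pow, coeff_nodeGf_mul_stepGf_pow, gf, coeff_mk] at h
  rw [h]
  ring

theorem totalD_eq (n l : ℕ) : totalD n l = l * offCentral n l := by
  have h := congrArg (coeff n) (gf_dfsSum l)
  rw [← map_natCast (C (R := ℤ)), coeff_C_mul, coeff_nodeGf_mul_stepGf_pow, gf, coeff_mk] at h
  simp only [totalD, sum_dfsScore]
  exact_mod_cast h

theorem totalB_eq (n l : ℕ) :
    (totalB n l : ℤ) = totalD n l + l * offCentral n (l + 1) -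
      ∑ i ∈ Finset.range l, ((offCentral n (l + 1 + i) : ℤ) + offCentral n (l + 1 + i + 1)) := by
  -- Doubling turns the binomial coefficient into w² - w, whose sum over trees is known.
  have hch : ∀ T : OrderedTree, (2 * ((width l T).choose 2) : ℤ) =
      (width l T : ℤ) * width (l + 0) T - width l T := by
    intro T
    rcases Nat.eq_zero_or_pos (width l T) with h | h
    · simp [h]
    · have h2 : width l T * (width l T - 1) = (width l T).choose 2 * 2 := by
        rw [Nat.choose_two_right, Nat.div_mul_cancel (Nat.even_mul_pred_self _).two_dvd]
      zify [h] at h2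
      simp only [add_zero]
      linarith
  have hB : (2 * totalB n l : ℤ) =
      2 * ∑ k ∈ Finset.range l, ∑ T ∈ treesWithEdges n, (width k T : ℤ) * width l T +
        ((∑ T ∈ treesWithEdges n, (width l T : ℤ) * width (l + 0) T) -
          ∑ T ∈ treesWithEdges n, (width l T : ℤ)) := by
    rw [Finset.sum_comm, ← Finset.sum_sub_distrib, totalB]
    push_cast
    rw [Finset.mul_sum, Finset.mul_sum, ← Finset.sum_add_distrib]
    refine Finset.sum_congr rfl fun T _ => ?_
    rw [← hch, ← Nat.cast_sum, sum_bfsScore]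
    push_cast
    rw [Finset.sum_mul]
    ring
  have hk : ∀ k ∈ Finset.range l, ∑ T ∈ treesWithEdges n, (width k T : ℤ) * width l T =
      (offCentral n l : ℤ) + offCentral n (l + 1) - 2 * offCentral n (l + k + 1) := by
    intro k hk
    have hkl := Finset.mem_range.1 hk
    have := sum_width_mul_width n k (l - k)
    rw [show k + (l - k) = l by omega, show 2 * k + (l - k) + 1 = l + k + 1 by omega] at this
    exact this
  -- Telescoping absorbs the boundary terms at `l + 1` and `2 * l + 1`, leaving exactly `l` pairs of
  -- neighbours to compare with `l` copies of `offCentral n (l + 1)`.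
  have htel : ∑ i ∈ Finset.range l,
      ((offCentral n (l + 1 + i) : ℤ) + offCentral n (l + 1 + i + 1)) =
      2 * ∑ i ∈ Finset.range l, (offCentral n (l + i + 1) : ℤ) - offCentral n (l + 1) +
        offCentral n (2 * l + 1) := by
    have := Finset.sum_range_sub (fun i => (offCentral n (l + 1 + i) : ℤ)) l
    rw [Finset.sum_sub_distrib] at this
    rw [Finset.sum_add_distrib]
    rw [show l + 1 + l = 2 * l + 1 by ring, add_zero] at this
    have e : ∀ i, l + i + 1 = l + 1 + i := fun i => by ring
    simp only [e]
    simp only [← add_assoc] at this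
    linarith
  rw [Finset.sum_congr rfl hk, Finset.sum_sub_distrib, Finset.sum_const, Finset.card_range,
    nsmul_eq_mul, ← Finset.mul_sum, sum_width_mul_width, sum_width] at hB
  rw [htel, totalD_eq]
  push_cast
  simp only [add_zero] at hB
  linarith

theorem totalB_le_totalD_iff (n l : ℕ) :
    totalB n l ≤ totalD n l ↔ l * offCentral n (l + 1) ≤
      ∑ i ∈ Finset.range l, (offCentral n (l + 1 + i) + offCentral n (l + 1 + i + 1)) := by
  have h := totalB_eq n l
  zify
  constructor <;> intro h' <;> linarith

theorem card_targets (n l : ℕ) :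
    ((targets n l).card : ℤ) = offCentral n l - offCentral n (l + 1) := by
  rw [targets, Finset.card_sigma, ← sum_width]
  push_cast
  simp only [card_lev]

theorem targets_nonempty {n l : ℕ} (h : l ≤ n) : (targets n l).Nonempty := by
  rw [← Finset.card_pos]
  have h1 := card_targets n l
  have h2 := offCentral_succ_mul n l
  have h3 := offCentral_pos h
  have h4 : offCentral n (l + 1) < offCentral n l := by
    by_contra! h4
    have : offCentral n l * (n + l + 1) ≤ offCentral n l * (n - l) :=
      (Nat.mul_le_mul_right _ h4).trans h2.le
    have := Nat.le_of_mul_le_mul_left this h3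
    omega
  omega

theorem averageB_le_averageD_iff {n l : ℕ} (h : l ≤ n) :
    averageB n l ≤ averageD n l ↔ totalB n l ≤ totalD n l := by
  have hpos : (0 : ℝ) < (targets n l).card := by
    exact_mod_cast (targets_nonempty h).card_pos
  have hB : averageB n l = totalB n l / (targets n l).card := by
    rw [averageB, Finset.expect_eq_sum_div_card, targets, Finset.sum_sigma, totalB]
    push_cast
    rfl
  have hD : averageD n l = totalD n l / (targets n l).card := by
    rw [averageD, Finset.expect_eq_sum_div_card, targets, Finset.sum_sigma, totalD]
    push_cast
    rfl
  rw [hB, hD, div_le_div_iff_of_pos_right hpos, Nat.cast_le]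

end OrderedTree

-- Monotonicity of the mean ratio and existence of thresholds.

open Filter Topology

theorem offCentral_succ_eq_mul (n m : ℕ) (h : m ≤ n) :
    (offCentral n (m + 1) : ℝ) = offCentral n m * (((n : ℝ) - m) / (n + m + 1)) := by
  have h1 := offCentral_succ_mul n m
  have h2 : (offCentral n (m + 1) : ℝ) * (n + m + 1) = offCentral n m * (n - m) := by
    rw [← Nat.cast_sub h]
    exact_mod_cast h1
  field_simp
  exact h2

theorem offCentral_antitone (n : ℕ) : Antitone (offCentral n) := by
  refine antitone_nat_of_succ_le fun m => ?_
  rcases le_or_gt m n with h | h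
  · have h1 := offCentral_succ_mul n m
    refine Nat.le_of_mul_le_mul_right (c := n + m + 1) ?_ (by omega)
    rw [h1]
    exact Nat.mul_le_mul_left _ (by omega)
  · rw [offCentral_eq_zero (by omega)]
    exact Nat.zero_le _

/-- Log-concavity: the quotient (n - m)/(n + m + 1) of consecutive coefficients decreases in `m`. -/
theorem offCentral_add_succ_mul_le (n m i : ℕ) :
    (offCentral n (m + i + 1) : ℝ) * offCentral n m ≤
      offCentral n (m + i) * offCentral n (m + 1) := by
  rcases le_or_gt (m + i) n with h | h
  · rw [offCentral_succ_eq_mul n _ h, offCentral_succ_eq_mul n m (by omega), mul_assoc]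
    refine mul_le_mul_of_nonneg_left ?_ (Nat.cast_nonneg _)
    rw [mul_comm]
    refine mul_le_mul_of_nonneg_left ?_ (Nat.cast_nonneg _)
    have h' : (m : ℝ) + i ≤ n := by exact_mod_cast h
    have hi : (0 : ℝ) ≤ i := Nat.cast_nonneg _
    push_cast
    apply div_le_div₀ <;> linarith
  · rw [offCentral_eq_zero (by omega : n < m + i + 1)]
    simp only [Nat.cast_zero, zero_mul]
    positivity

/-- The ratios whose mean over `l ≤ k < 2 * l` is `meanRatio n l`. -/
noncomputable def shiftRatio (n l k : ℕ) : ℝ :=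
  ((offCentral n (k + 1) : ℝ) + offCentral n (k + 2)) / offCentral n (l + 1)

/-- The mean ratio whose comparison with `1` decides whether BFS or DFS is better. -/
noncomputable def meanRatio (n l : ℕ) : ℝ :=
  (∑ i ∈ Finset.range l, shiftRatio n l (l + i)) / l

theorem shiftRatio_nonneg (n l k : ℕ) : 0 ≤ shiftRatio n l k := by
  unfold shiftRatio
  positivity

theorem shiftRatio_antitone (n l : ℕ) : Antitone (shiftRatio n l) := by
  intro a b h
  have h1 := offCentral_antitone n (show a + 1 ≤ b + 1 by omega)
  have h2 := offCentral_antitone n (show a + 2 ≤ b + 2 by omega)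
  unfold shiftRatio
  gcongr

theorem shiftRatio_le_two {n l k : ℕ} (h : l ≤ k) : shiftRatio n l k ≤ 2 := by
  have h1 : (offCentral n (k + 1) : ℝ) ≤ offCentral n (l + 1) :=
    Nat.cast_le.2 (offCentral_antitone n (by omega))
  have h2 : (offCentral n (k + 2) : ℝ) ≤ offCentral n (l + 1) :=
    Nat.cast_le.2 (offCentral_antitone n (by omega))
  exact div_le_of_le_mul₀ (Nat.cast_nonneg _) (by norm_num) (by linarith)

theorem shiftRatio_succ_le {n l : ℕ} (h : l + 1 < n) (i : ℕ) :
    shiftRatio n (l + 1) (l + 1 + i) ≤ shiftRatio n l (l + i) := by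
  have h1 : (0 : ℝ) < offCentral n (l + 1) := Nat.cast_pos.2 (offCentral_pos (by omega))
  have h2 : (0 : ℝ) < offCentral n (l + 1 + 1) := Nat.cast_pos.2 (offCentral_pos (by omega))
  have h3 := offCentral_add_succ_mul_le n (l + 1) i
  have h4 := offCentral_add_succ_mul_le n (l + 1) (i + 1)
  unfold shiftRatio
  rw [div_le_div_iff₀ h2 h1]
  rw [show l + 1 + i + 2 = l + 1 + (i + 1) + 1 by ring, show l + i + 1 = l + 1 + i by ring,
    show l + i + 2 = l + 1 + (i + 1) by ring]
  linarith

theorem meanRatio_succ_le {n l : ℕ} (hl : 1 ≤ l) (h : l + 1 < n) :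
    meanRatio n (l + 1) ≤ meanRatio n l := by
  have hl' : (0 : ℝ) < l := by exact_mod_cast hl
  have h1 : ∑ i ∈ Finset.range (l + 1), shiftRatio n (l + 1) (l + 1 + i) ≤
      ∑ i ∈ Finset.range (l + 1), shiftRatio n l (l + i) :=
    Finset.sum_le_sum fun i _ => shiftRatio_succ_le h i
  -- The additional term is at most each of the others, so including it cannot raise the mean.
  have h2 : (l : ℝ) * shiftRatio n l (l + l) ≤ ∑ i ∈ Finset.range l, shiftRatio n l (l + i) := by
    have := Finset.card_nsmul_le_sum (Finset.range l) (fun i => shiftRatio n l (l + i))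
      (shiftRatio n l (l + l)) fun i hi =>
        shiftRatio_antitone n l (by have := Finset.mem_range.1 hi; omega)
    simpa using this
  rw [Finset.sum_range_succ (fun i => shiftRatio n l (l + i)) l] at h1
  unfold meanRatio
  rw [div_le_div_iff₀ (by positivity) hl']
  push_cast
  nlinarith

namespace OrderedTree

theorem totalB_le_totalD_iff_meanRatio {n l : ℕ} (hl : 1 ≤ l) (h : l < n) :
    totalB n l ≤ totalD n l ↔ 1 ≤ meanRatio n l := by
  have hl' : (0 : ℝ) < l := by exact_mod_cast hl
  have h1 : (0 : ℝ) < offCentral n (l + 1) := Nat.cast_pos.2 (offCentral_pos (by omega))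
  rw [totalB_le_totalD_iff, meanRatio, one_le_div hl']
  simp only [shiftRatio]
  rw [← Finset.sum_div, le_div_iff₀ h1, ← Nat.cast_le (α := ℝ)]
  push_cast
  simp only [show ∀ i, l + 1 + i = l + i + 1 from fun i => by ring,
    show ∀ i, l + i + 2 = l + i + 1 + 1 from fun i => by ring]

theorem totalB_zero_le (n : ℕ) : totalB n 0 ≤ totalD n 0 := by
  simp [totalB_le_totalD_iff]

theorem totalB_le_totalD_of_le {n l m : ℕ} (hlm : l ≤ m) (hm : m < n)
    (h : totalB n m ≤ totalD n m) : totalB n l ≤ totalD n l := by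
  induction m, hlm using Nat.le_induction with
  | base => exact h
  | succ m hlm ih =>
    refine ih (by omega) ?_
    -- Level 0 is separate because `meanRatio n 0` is 0 by the convention for division by zero.
    rcases Nat.eq_zero_or_pos m with rfl | hm0
    · exact totalB_zero_le n
    · rw [totalB_le_totalD_iff_meanRatio (by omega) hm] at h
      rw [totalB_le_totalD_iff_meanRatio hm0 (by omega)]
      exact h.trans (meanRatio_succ_le hm0 hm)

theorem exists_isThreshold {n : ℕ} (hn : 1 ≤ n) : ∃ t : ℝ, IsThreshold n t := by
  classical
  set S := (Finset.range n).filter fun l => totalB n l ≤ totalD n l with hS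
  have hne : S.Nonempty := ⟨0, by simp [hS, totalB_zero_le]; omega⟩
  have hmax := S.max'_mem hne
  simp only [hS, Finset.mem_filter, Finset.mem_range] at hmax
  refine ⟨(S.max' hne : ℕ), fun l hl => ?_⟩
  rw [Nat.cast_le]
  refine ⟨fun h => S.le_max' l ?_, fun h => totalB_le_totalD_of_le h hmax.1 hmax.2⟩
  simp [hS, hl, h]

end OrderedTree

-- Gaussian limit of the binomial coefficients and of the mean ratio.

/-- Each quotient is 1 - (2m + 1)/(n + m + 1), bounded by an exponential; the odd numbers add up to
m². The cap `M` keeps one denominator throughout the induction. -/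
theorem offCentral_le_exp (n M m : ℕ) (hn : 0 < n) (hm : m ≤ M) :
    (offCentral n m : ℝ) ≤ offCentral n 0 * Real.exp (-(m : ℝ) ^ 2 / (n + M)) := by
  have hn' : (0 : ℝ) < n := by exact_mod_cast hn
  induction m with
  | zero => simp
  | succ m ih =>
    have hM : (m : ℝ) + 1 ≤ M := by exact_mod_cast hm
    rcases le_or_gt m n with h | h
    · have h' : (m : ℝ) ≤ n := by exact_mod_cast h
      have hstep : ((n : ℝ) - m) / (n + m + 1) ≤ Real.exp (-(2 * m + 1) / (n + M)) := by
        have h1 : ((n : ℝ) - m) / (n + m + 1) = -(2 * m + 1) / (n + m + 1) + 1 := by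
          field_simp
          ring
        have h2 : -(2 * (m : ℝ) + 1) / (n + m + 1) ≤ -(2 * m + 1) / (n + M) := by
          rw [neg_div, neg_div, neg_le_neg_iff]
          exact div_le_div_of_nonneg_left (by positivity) (by positivity) (by linarith)
        have := Real.add_one_le_exp (-(2 * (m : ℝ) + 1) / (n + M))
        linarith
      rw [offCentral_succ_eq_mul n m h]
      calc (offCentral n m : ℝ) * (((n : ℝ) - m) / (n + m + 1))
          ≤ (offCentral n 0 * Real.exp (-(m : ℝ) ^ 2 / (n + M))) *
              Real.exp (-(2 * m + 1) / (n + M)) :=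
            mul_le_mul (ih (by omega)) hstep (div_nonneg (by linarith) (by positivity))
              (by positivity)
        _ = _ := by
          rw [mul_assoc, ← Real.exp_add]
          congr 2
          push_cast
          ring
    · rw [offCentral_eq_zero (by omega : n < m + 1)]
      simp only [Nat.cast_zero]
      positivity

/-- The inverse quotient is 1 + (2m + 1)/(n - m), so the same exponential inequality bounds it from
above. -/
theorem exp_le_offCentral (n M m : ℕ) (hM : M < n) (hm : m ≤ M) :
    offCentral n 0 * Real.exp (-(m : ℝ) ^ 2 / (n - M)) ≤ (offCentral n m : ℝ) := by
  have hM' : (M : ℝ) < n := by exact_mod_cast hM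
  induction m with
  | zero => simp
  | succ m ih =>
    have hmM : (m : ℝ) + 1 ≤ M := by exact_mod_cast hm
    have hd : (0 : ℝ) < n - m := by linarith
    have hd' : (0 : ℝ) < n - M := by linarith
    have hstep : Real.exp (-(2 * m + 1) / (n - M)) ≤ ((n : ℝ) - m) / (n + m + 1) := by
      have h1 : ((n : ℝ) - m) / (n + m + 1) = ((2 * (m : ℝ) + 1) / (n - m) + 1)⁻¹ := by
        field_simp
        ring
      have h2 : (2 * (m : ℝ) + 1) / (n - m) ≤ (2 * m + 1) / (n - M) :=
        div_le_div_of_nonneg_left (by positivity) hd' (by linarith)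
      have h3 := Real.add_one_le_exp ((2 * (m : ℝ) + 1) / (n - M))
      rw [h1, neg_div, Real.exp_neg]
      exact inv_anti₀ (by positivity) (by linarith)
    rw [offCentral_succ_eq_mul n m (by omega)]
    calc (offCentral n 0 : ℝ) * Real.exp (-((m + 1 : ℕ) : ℝ) ^ 2 / (n - M))
        = (offCentral n 0 * Real.exp (-(m : ℝ) ^ 2 / (n - M))) *
              Real.exp (-(2 * m + 1) / (n - M)) := by
          rw [mul_assoc, ← Real.exp_add]
          congr 2
          push_cast
          ring
      _ ≤ _ := mul_le_mul (ih (by omega)) hstep (by positivity) (by positivity)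

theorem tendsto_div_of_tendsto_div_sqrt {m : ℕ → ℕ} {y : ℝ}
    (h : Tendsto (fun n => (m n : ℝ) / √(n : ℝ)) atTop (𝓝 y)) :
    Tendsto (fun n => (m n : ℝ) / n) atTop (𝓝 0) := by
  have h1 : Tendsto (fun n : ℕ => (√(n : ℝ))⁻¹) atTop (𝓝 0) :=
    (Real.tendsto_sqrt_atTop.comp tendsto_natCast_atTop_atTop).inv_tendsto_atTop
  have h2 := h.mul h1
  rw [mul_zero] at h2
  refine h2.congr fun n => ?_
  rw [← div_eq_mul_inv, div_div, Real.mul_self_sqrt (Nat.cast_nonneg _)]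

theorem tendsto_offCentral_div {m : ℕ → ℕ} {y : ℝ}
    (h : Tendsto (fun n => (m n : ℝ) / √(n : ℝ)) atTop (𝓝 y)) :
    Tendsto (fun n => (offCentral n (m n) : ℝ) / offCentral n 0) atTop
      (𝓝 (Real.exp (-y ^ 2))) := by
  have h0 := tendsto_div_of_tendsto_div_sqrt h
  -- The values `c = -1` and `c = 1` give the lower and the upper bound of the squeeze, with cap `M
  -- = m n`.
  have hexp : ∀ c : ℝ, Tendsto (fun n : ℕ =>
      Real.exp (-((m n : ℝ) / √(n : ℝ)) ^ 2 / (1 + c * ((m n : ℝ) / n)))) atTop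
      (𝓝 (Real.exp (-y ^ 2))) := by
    intro c
    have h1 : Tendsto (fun n : ℕ => -((m n : ℝ) / √(n : ℝ)) ^ 2 / (1 + c * ((m n : ℝ) / n)))
        atTop (𝓝 (-y ^ 2 / (1 + c * 0))) :=
      ((h.pow 2).neg).div ((h0.const_mul c).const_add 1) (by norm_num)
    rw [mul_zero, add_zero, div_one] at h1
    exact (Real.continuous_exp.tendsto _).comp h1
  have heq : ∀ (c : ℝ) (n : ℕ), 0 < n → -(m n : ℝ) ^ 2 / (n + c * m n) =
      -((m n : ℝ) / √(n : ℝ)) ^ 2 / (1 + c * ((m n : ℝ) / n)) := by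
    intro c n hn
    have hn' : (0 : ℝ) < n := by exact_mod_cast hn
    rw [div_pow, Real.sq_sqrt hn'.le, ← neg_div, div_div, mul_add, mul_one]
    congr 2
    field_simp
  have hlt : ∀ᶠ n in atTop, (m n : ℝ) / n < 1 := h0.eventually_lt_const zero_lt_one
  refine tendsto_of_tendsto_of_tendsto_of_le_of_le' (hexp (-1)) (hexp 1) ?_ ?_
  · filter_upwards [hlt, eventually_gt_atTop 0] with n hn hn0
    have hn' : (0 : ℝ) < n := by exact_mod_cast hn0
    rw [div_lt_one hn'] at hn
    rw [← heq _ n hn0, le_div_iff₀ (Nat.cast_pos.2 (offCentral_pos (Nat.zero_le _))), mul_comm]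
    have := exp_le_offCentral n (m n) (m n) (by exact_mod_cast hn) le_rfl
    rwa [sub_eq_add_neg, ← neg_one_mul (m n : ℝ)] at this
  · filter_upwards [eventually_gt_atTop 0] with n hn0
    rw [← heq _ n hn0, div_le_iff₀ (Nat.cast_pos.2 (offCentral_pos (Nat.zero_le _))), mul_comm,
      one_mul]
    exact offCentral_le_exp n (m n) (m n) hn0 le_rfl

/-- Writing the mean as the integral of a step function over a fixed interval lets dominated
convergence (with bound 2) give the limit. -/
theorem integral_floor (f : ℕ → ℝ) {l : ℕ} (hl : 0 < l) :
    ∫ s in (1 : ℝ)..2, f ⌊s * l⌋₊ = (∑ i ∈ Finset.range l, f (l + i)) / l := by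
  have hl' : (l : ℝ) ≠ 0 := by positivity
  rw [intervalIntegral.integral_comp_mul_right (fun u => f ⌊u⌋₊) hl', smul_eq_mul,
    inv_mul_eq_div]
  congr 1
  have hpiece : ∀ k : ℕ, Set.EqOn (fun _ : ℝ => f k) (fun u : ℝ => f ⌊u⌋₊)
      (Set.Ioo (k : ℝ) ((k + 1 : ℕ) : ℝ)) := by
    intro k u hu
    simp only
    rw [(Nat.floor_eq_iff ((Nat.cast_nonneg k).trans hu.1.le)).2
      ⟨hu.1.le, by have := hu.2; push_cast at this; exact this⟩]
  have hle : ∀ k : ℕ, (k : ℝ) ≤ ((k + 1 : ℕ) : ℝ) := fun k => by push_cast; linarith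
  have hsum := intervalIntegral.sum_integral_adjacent_intervals_Ico
    (f := fun u : ℝ => f ⌊u⌋₊) (μ := MeasureTheory.volume) (a := fun k : ℕ => (k : ℝ))
    (m := l) (n := 2 * l) (by omega) (fun k _ => by
      refine (intervalIntegrable_const (c := f k)).congr_uIoo ?_
      rw [Set.uIoo_of_le (hle k)]
      exact hpiece k)
  have hval : ∀ k : ℕ, ∫ u in (k : ℝ)..((k + 1 : ℕ) : ℝ), f ⌊u⌋₊ = f k := by
    intro k
    rw [← intervalIntegral.integral_congr_Ioo_of_le (hle k) (hpiece k)]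
    simp
  simp only [hval] at hsum
  rw [Finset.sum_Ico_eq_sum_range, show 2 * l - l = l by omega] at hsum
  rw [hsum, one_mul]
  push_cast
  rfl

/-- The limit of `meanRatio n l` as `n` tends to infinity with `l` asymptotic to `x * √n`. -/
noncomputable def limitRatio (x : ℝ) : ℝ :=
  ∫ s in (1 : ℝ)..2, 2 * Real.exp (-(x ^ 2 * (s ^ 2 - 1)))

theorem tendsto_natCast_atTop_of_div_sqrt {l : ℕ → ℕ} {x : ℝ} (hx : 0 < x)
    (h : Tendsto (fun n => (l n : ℝ) / √(n : ℝ)) atTop (𝓝 x)) :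
    Tendsto (fun n => (l n : ℝ)) atTop atTop := by
  have h1 : Tendsto (fun n : ℕ => √(n : ℝ)) atTop atTop :=
    Real.tendsto_sqrt_atTop.comp tendsto_natCast_atTop_atTop
  refine (h.pos_mul_atTop hx h1).congr' ?_
  filter_upwards [eventually_gt_atTop 0] with n hn
  have : √(n : ℝ) ≠ 0 := by positivity
  field_simp

theorem tendsto_shiftRatio {l k : ℕ → ℕ} {x y : ℝ}
    (hl : Tendsto (fun n => (l n : ℝ) / √(n : ℝ)) atTop (𝓝 x))
    (hk : Tendsto (fun n => (k n : ℝ) / √(n : ℝ)) atTop (𝓝 y)) :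
    Tendsto (fun n => shiftRatio n (l n) (k n)) atTop
      (𝓝 (2 * Real.exp (-(y ^ 2 - x ^ 2)))) := by
  have h0 : Tendsto (fun n : ℕ => (√(n : ℝ))⁻¹) atTop (𝓝 0) :=
    (Real.tendsto_sqrt_atTop.comp tendsto_natCast_atTop_atTop).inv_tendsto_atTop
  have hadd : ∀ (m : ℕ → ℕ) (z : ℝ) (c : ℕ),
      Tendsto (fun n => (m n : ℝ) / √(n : ℝ)) atTop (𝓝 z) →
      Tendsto (fun n => ((m n + c : ℕ) : ℝ) / √(n : ℝ)) atTop (𝓝 z) := by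
    intro m z c hm
    have := hm.add (h0.const_mul (c : ℝ))
    rw [mul_zero, add_zero] at this
    refine this.congr fun n => ?_
    push_cast
    rw [add_div, div_eq_mul_inv (c : ℝ)]
  have h1 := tendsto_offCentral_div (hadd k y 1 hk)
  have h2 := tendsto_offCentral_div (hadd k y 2 hk)
  have h3 := tendsto_offCentral_div (hadd l x 1 hl)
  have h4 := (h1.add h2).div h3 (Real.exp_ne_zero _)
  rw [← two_mul, mul_div_assoc, ← Real.exp_sub,
    show -y ^ 2 - -x ^ 2 = -(y ^ 2 - x ^ 2) by ring] at h4
  refine h4.congr fun n => ?_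
  have : (offCentral n 0 : ℝ) ≠ 0 := Nat.cast_ne_zero.2 (offCentral_pos (Nat.zero_le _)).ne'
  simp only [Pi.div_apply, shiftRatio]
  rw [← add_div, div_div_div_cancel_right₀ this]

theorem tendsto_meanRatio {l : ℕ → ℕ} {x : ℝ} (hx : 0 < x)
    (h : Tendsto (fun n => (l n : ℝ) / √(n : ℝ)) atTop (𝓝 x)) :
    Tendsto (fun n => meanRatio n (l n)) atTop (𝓝 (limitRatio x)) := by
  have hatTop := tendsto_natCast_atTop_of_div_sqrt hx h
  have hpos : ∀ᶠ n in atTop, 0 < l n := by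
    filter_upwards [hatTop.eventually_gt_atTop 0] with n hn
    exact_mod_cast hn
  have hlim : Tendsto (fun n => ∫ s in (1 : ℝ)..2, shiftRatio n (l n) ⌊s * l n⌋₊) atTop
      (𝓝 (limitRatio x)) := by
    refine intervalIntegral.tendsto_integral_filter_of_dominated_convergence (fun _ => 2)
      (Eventually.of_forall fun n => ?_) (Eventually.of_forall fun n => ?_)
      intervalIntegrable_const ?_
    · have hm : Measurable fun s : ℝ => ⌊s * l n⌋₊ :=
        Nat.measurable_floor.comp (measurable_id.mul_const _)
      exact ((measurable_from_nat (f := shiftRatio n (l n))).comp hm).aestronglyMeasurable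
    · refine Eventually.of_forall fun s hs => ?_
      rw [Set.uIoc_of_le (by norm_num)] at hs
      rw [Real.norm_of_nonneg (shiftRatio_nonneg _ _ _)]
      refine shiftRatio_le_two (Nat.le_floor ?_)
      have : (0 : ℝ) ≤ l n := Nat.cast_nonneg _
      nlinarith [hs.1]
    · refine Eventually.of_forall fun s hs => ?_
      rw [Set.uIoc_of_le (by norm_num)] at hs
      have hfloor : Tendsto (fun n => ((⌊s * l n⌋₊ : ℕ) : ℝ) / √(n : ℝ)) atTop (𝓝 (s * x)) := by
        have h1 := (tendsto_nat_floor_mul_div_atTop (R := ℝ) (a := s)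
          (by linarith [hs.1])).comp hatTop
        refine (h1.mul h).congr' ?_
        filter_upwards [hpos] with n hn
        have : (l n : ℝ) ≠ 0 := by positivity
        simp only [Function.comp]
        field_simp
      have := tendsto_shiftRatio h hfloor
      rwa [show (s * x) ^ 2 - x ^ 2 = x ^ 2 * (s ^ 2 - 1) by ring] at this
  refine hlim.congr' ?_
  filter_upwards [hpos] with n hn
  exact integral_floor _ hn

theorem continuous_limitRatio : Continuous limitRatio := by
  unfold limitRatio
  apply intervalIntegral.continuous_parametric_intervalIntegral_of_continuous'
  unfold Function.uncurry
  fun_prop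

theorem limitRatio_lt {x y : ℝ} (hx : 0 ≤ x) (hxy : x < y) : limitRatio y < limitRatio x := by
  have hsq : x ^ 2 < y ^ 2 := by nlinarith
  refine intervalIntegral.integral_lt_integral_of_continuousOn_of_le_of_exists_lt (by norm_num)
    (by fun_prop) (by fun_prop) (fun s hs => ?_) ⟨2, by norm_num, ?_⟩
  · have : 0 ≤ s ^ 2 - 1 := by nlinarith [hs.1]
    gcongr
  · gcongr

-- The threshold equation and its numerical root.

theorem stdNormalCDF_sub (a b : ℝ) :
    stdNormalCDF b - stdNormalCDF a =
      ∫ t in a..b, ProbabilityTheory.gaussianPDFReal 0 1 t := by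
  have h : ∀ x, stdNormalCDF x =
      ∫ t in Set.Iic x, ProbabilityTheory.gaussianPDFReal 0 1 t := by
    intro x
    rw [stdNormalCDF, ProbabilityTheory.cdf_eq_real, MeasureTheory.measureReal_def,
      ProbabilityTheory.gaussianReal_apply_eq_integral _ one_ne_zero, ENNReal.toReal_ofReal]
    exact MeasureTheory.integral_nonneg fun t => ProbabilityTheory.gaussianPDFReal_nonneg _ _ _
  have hi := ProbabilityTheory.integrable_gaussianPDFReal 0 1
  rw [h, h, intervalIntegral.integral_Iic_sub_Iic hi.integrableOn hi.integrableOn]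

/-- The substitution t = √2 x s carries the Gaussian integral from √2 x to 2√2 x to the interval
from 1 to 2. -/
theorem thresholdFun_eq (x : ℝ) :
    thresholdFun x = x * Real.exp (-x ^ 2) * (1 - limitRatio x) := by
  have h1 : stdNormalCDF (2 * √2 * x) - stdNormalCDF (√2 * x) =
      (√2 * x) * ∫ s in (1 : ℝ)..2, ProbabilityTheory.gaussianPDFReal 0 1 (√2 * x * s) := by
    rw [stdNormalCDF_sub, intervalIntegral.mul_integral_comp_mul_left, mul_one]
    congr 1
    ring
  have h2 : ∀ s : ℝ, ProbabilityTheory.gaussianPDFReal 0 1 (√2 * x * s) =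
      (2 * √2 * √Real.pi)⁻¹ * Real.exp (-x ^ 2) *
        (2 * Real.exp (-(x ^ 2 * (s ^ 2 - 1)))) := by
    intro s
    have e : -(√2 * x * s - 0) ^ 2 / (2 * ((1 : NNReal) : ℝ)) =
        -x ^ 2 + -(x ^ 2 * (s ^ 2 - 1)) := by
      rw [sub_zero, mul_pow, mul_pow, Real.sq_sqrt (by norm_num)]
      simp
      ring
    rw [ProbabilityTheory.gaussianPDFReal, e, Real.exp_add]
    simp only [NNReal.coe_one, mul_one]
    rw [Real.sqrt_mul (by norm_num)]
    field_simp
  simp only [h2] at h1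
  rw [intervalIntegral.integral_const_mul, ← limitRatio] at h1
  rw [thresholdFun, h1]
  have hpi : √Real.pi ≠ 0 := by positivity
  have h2' : √(2 : ℝ) ≠ 0 := by positivity
  field_simp

/-- The integral of `(s ^ 2 - 1) ^ k` over `1 ≤ s ≤ 2`. -/
def momentIntegral : ℕ → ℚ
  | 0 => 1
  | k + 1 => (2 * 3 ^ (k + 1) - 2 * (k + 1) * momentIntegral k) / (2 * k + 3)

theorem integral_sq_sub_one_pow (k : ℕ) :
    ∫ s in (1 : ℝ)..2, (s ^ 2 - 1) ^ k = (momentIntegral k : ℝ) := by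
  induction k with
  | zero => norm_num [momentIntegral]
  | succ k ih =>
    -- Writing s² = (s² - 1) + 1 in the derivative links consecutive moments; the boundary term
    -- vanishes at 1 and is 2 · 3^(k+1) at 2.
    have hd : ∀ s ∈ Set.uIcc (1 : ℝ) 2, HasDerivAt (fun s : ℝ => s * (s ^ 2 - 1) ^ (k + 1))
        ((2 * k + 3) * (s ^ 2 - 1) ^ (k + 1) + 2 * (k + 1) * (s ^ 2 - 1) ^ k) s := by
      intro s _
      have h := (hasDerivAt_id s).mul ((((hasDerivAt_id s).pow 2).sub_const 1).pow (k + 1))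
      refine h.congr_deriv ?_
      simp
      ring
    have hint := intervalIntegral.integral_eq_sub_of_hasDerivAt hd
      (Continuous.intervalIntegrable (by fun_prop) _ _)
    rw [intervalIntegral.integral_add (Continuous.intervalIntegrable (by fun_prop) _ _)
      (Continuous.intervalIntegrable (by fun_prop) _ _), intervalIntegral.integral_const_mul,
      intervalIntegral.integral_const_mul, ih] at hint
    rw [momentIntegral]
    push_cast
    rw [eq_div_iff (by positivity)]
    norm_num at hint
    linarith

/-- The Taylor approximation of order `K` of `limitRatio x`, in terms of `c = x ^ 2`. -/
def limitRatioTaylor (K : ℕ) (c : ℚ) : ℚ :=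
  2 * ∑ k ∈ Finset.range K, (-c) ^ k / k.factorial * momentIntegral k

theorem abs_exp_sub_sum_le (u : ℝ) (K : ℕ) (h : |u| / (K + 1) ≤ 1 / 2) :
    |Real.exp u - ∑ k ∈ Finset.range K, u ^ k / k.factorial| ≤ |u| ^ K / K.factorial * 2 := by
  have := Complex.exp_bound' (x := (u : ℂ)) (n := K) (by
    rw [Complex.norm_real, Real.norm_eq_abs]
    push_cast
    exact h)
  rw [Complex.norm_real, Real.norm_eq_abs] at this
  rw [← Real.norm_eq_abs, ← Complex.norm_real]
  push_cast
  exact this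

theorem abs_limitRatio_sub_le (x : ℝ) (c : ℚ) (hx : x ^ 2 = c) (K : ℕ)
    (hK : 3 * (c : ℝ) / (K + 1) ≤ 1 / 2) :
    |limitRatio x - limitRatioTaylor K c| ≤ 4 * (3 * (c : ℝ)) ^ K / K.factorial := by
  have hc : (0 : ℝ) ≤ c := hx ▸ sq_nonneg x
  have hT : (limitRatioTaylor K c : ℝ) = ∫ s in (1 : ℝ)..2,
      2 * ∑ k ∈ Finset.range K, (-(x ^ 2 * (s ^ 2 - 1))) ^ k / k.factorial := by
    rw [intervalIntegral.integral_const_mul, intervalIntegral.integral_finsetSum fun k _ =>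
      Continuous.intervalIntegrable (by fun_prop) _ _, limitRatioTaylor]
    push_cast
    congr 1
    refine Finset.sum_congr rfl fun k _ => ?_
    rw [← integral_sq_sub_one_pow, ← intervalIntegral.integral_const_mul]
    congr 1
    ext s
    rw [← hx, ← neg_mul, mul_pow]
    ring
  rw [hT, limitRatio, ← intervalIntegral.integral_sub
    (Continuous.intervalIntegrable (by fun_prop) _ _)
    (Continuous.intervalIntegrable (by fun_prop) _ _), ← Real.norm_eq_abs]
  have hb := intervalIntegral.norm_integral_le_of_norm_le_const (a := (1 : ℝ)) (b := 2)
    (f := fun s : ℝ => 2 * Real.exp (-(x ^ 2 * (s ^ 2 - 1))) -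
      2 * ∑ k ∈ Finset.range K, (-(x ^ 2 * (s ^ 2 - 1))) ^ k / k.factorial)
    (C := 4 * (3 * (c : ℝ)) ^ K / K.factorial) (fun s hs => by
      rw [Set.uIoc_of_le (by norm_num)] at hs
      have h1 : 0 ≤ s ^ 2 - 1 := by nlinarith [hs.1]
      have h3 : s ^ 2 - 1 ≤ 3 := by nlinarith [hs.1, hs.2]
      have hu : |-(x ^ 2 * (s ^ 2 - 1))| ≤ 3 * (c : ℝ) := by
        rw [abs_neg, abs_of_nonneg (by positivity), hx]
        nlinarith
      have h := abs_exp_sub_sum_le (-(x ^ 2 * (s ^ 2 - 1))) K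
        (le_trans (by gcongr) hK)
      rw [← mul_sub, Real.norm_eq_abs, abs_mul, abs_of_pos (by norm_num : (0 : ℝ) < 2)]
      have h4 : |-(x ^ 2 * (s ^ 2 - 1))| ^ K / K.factorial ≤ (3 * (c : ℝ)) ^ K / K.factorial := by
        gcongr
      rw [mul_div_assoc]
      linarith)
  refine hb.trans ?_
  norm_num

/-- The point is 0.789004 - 5·10⁻⁷. With 16 terms the Taylor error is below 1/2000000, and the
rational Taylor value exceeds 1 by more than that. -/
theorem one_lt_limitRatio : 1 < limitRatio 0.7890035 := by
  have h := abs_limitRatio_sub_le 0.7890035 (0.7890035 ^ 2) (by norm_num) 16 (by norm_num)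
  have ht : (1 + 1 / 2000000 : ℚ) < limitRatioTaylor 16 (0.7890035 ^ 2) := by
    norm_num [limitRatioTaylor, momentIntegral, Finset.sum_range_succ, Nat.factorial]
  have ht' : ((1 + 1 / 2000000 : ℚ) : ℝ) < limitRatioTaylor 16 (0.7890035 ^ 2) :=
    Rat.cast_lt.2 ht
  have hr : 4 * (3 * ((0.7890035 ^ 2 : ℚ) : ℝ)) ^ 16 / (Nat.factorial 16) ≤ 1 / 2000000 := by
    norm_num [Nat.factorial]
  have := (abs_le.1 h).1
  push_cast at ht' this hr
  linarith

theorem limitRatio_lt_one : limitRatio 0.7890045 < 1 := by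
  have h := abs_limitRatio_sub_le 0.7890045 (0.7890045 ^ 2) (by norm_num) 16 (by norm_num)
  have ht : limitRatioTaylor 16 (0.7890045 ^ 2) < (1 - 1 / 2000000 : ℚ) := by
    norm_num [limitRatioTaylor, momentIntegral, Finset.sum_range_succ, Nat.factorial]
  have ht' : (limitRatioTaylor 16 (0.7890045 ^ 2) : ℝ) < ((1 - 1 / 2000000 : ℚ) : ℝ) :=
    Rat.cast_lt.2 ht
  have hr : 4 * (3 * ((0.7890045 ^ 2 : ℚ) : ℝ)) ^ 16 / (Nat.factorial 16) ≤ 1 / 2000000 := by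
    norm_num [Nat.factorial]
  have := (abs_le.1 h).2
  push_cast at ht' this hr
  linarith

theorem exists_limitRatio_eq_one :
    ∃ lam : ℝ, 0 < lam ∧ limitRatio lam = 1 ∧ |lam - 0.789004| ≤ 5 / 10 ^ 7 := by
  obtain ⟨lam, hmem, hlam⟩ := intermediate_value_Icc' (by norm_num : (0.7890035 : ℝ) ≤ 0.7890045)
    continuous_limitRatio.continuousOn ⟨limitRatio_lt_one.le, one_lt_limitRatio.le⟩
  have h1 := hmem.1
  have h2 := hmem.2
  refine ⟨lam, by linarith, hlam, abs_le.2 ⟨?_, ?_⟩⟩ <;> norm_num at h1 h2 ⊢ <;> linarith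

-- Asymptotics of the thresholds.

namespace OrderedTree

theorem tendsto_floor_mul_sqrt_div {c : ℝ} (hc : 0 ≤ c) :
    Tendsto (fun n : ℕ => ((⌊c * √(n : ℝ)⌋₊ : ℕ) : ℝ) / √(n : ℝ)) atTop (𝓝 c) :=
  (tendsto_nat_floor_mul_div_atTop hc).comp
    (Real.tendsto_sqrt_atTop.comp tendsto_natCast_atTop_atTop)

theorem eventually_floor_mul_sqrt {c : ℝ} (hc : 0 < c) :
    ∀ᶠ n : ℕ in atTop, 1 ≤ ⌊c * √(n : ℝ)⌋₊ ∧ ⌊c * √(n : ℝ)⌋₊ < n := by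
  have h := tendsto_floor_mul_sqrt_div hc.le
  filter_upwards [(tendsto_natCast_atTop_of_div_sqrt hc h).eventually_ge_atTop 1,
    (tendsto_div_of_tendsto_div_sqrt h).eventually_lt_const zero_lt_one,
    eventually_gt_atTop 0] with n h1 h2 h3
  have h3' : (0 : ℝ) < n := by exact_mod_cast h3
  rw [div_lt_one h3'] at h2
  exact ⟨by exact_mod_cast h1, by exact_mod_cast h2⟩

theorem tendsto_threshold_div_sqrt {lam : ℝ} (hlam : 0 < lam) (h1 : limitRatio lam = 1)
    {L : ℕ → ℝ} (hL : ∀ n : ℕ, 1 ≤ n → IsThreshold n (L n)) :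
    Tendsto (fun n => L n / √(n : ℝ)) atTop (𝓝 lam) := by
  have hsqrt : Tendsto (fun n : ℕ => √(n : ℝ)) atTop atTop :=
    Real.tendsto_sqrt_atTop.comp tendsto_natCast_atTop_atTop
  refine tendsto_order.2 ⟨fun a ha => ?_, fun a ha => ?_⟩
  -- The maximum with 0 keeps `c` positive even when `a` is negative. At level ⌊c√n⌋ the mean ratio
  -- is eventually above 1, which forces that level to be at most `L n`.
  · obtain ⟨c, hc1, hc2⟩ := exists_between (max_lt ha hlam)
    have hc0 : 0 < c := (le_max_right _ _).trans_lt hc1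
    have hlim := tendsto_meanRatio hc0 (tendsto_floor_mul_sqrt_div hc0.le)
    have hgt : 1 < limitRatio c := h1 ▸ limitRatio_lt hc0.le hc2
    filter_upwards [hlim.eventually_const_lt hgt, eventually_floor_mul_sqrt hc0,
      eventually_gt_atTop 0,
      (tendsto_floor_mul_sqrt_div hc0.le).eventually_const_lt ((le_max_left _ _).trans_lt hc1)]
      with n hn hfl hn0 hlt
    have hle := (hL n hn0 _ hfl.2).1 ((totalB_le_totalD_iff_meanRatio hfl.1 hfl.2).2 hn.le)
    exact hlt.trans_le (by gcongr)
  · obtain ⟨c, hc1, hc2⟩ := exists_between ha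
    have hc0 : 0 < c := hlam.trans hc1
    have hlim := tendsto_meanRatio hc0 (tendsto_floor_mul_sqrt_div hc0.le)
    have hgt : limitRatio c < 1 := h1 ▸ limitRatio_lt hlam.le hc1
    filter_upwards [hlim.eventually_lt_const hgt, eventually_floor_mul_sqrt hc0,
      eventually_gt_atTop 0,
      (tendsto_floor_mul_sqrt_div hc0.le).eventually_lt_const hc2] with n hn hfl hn0 hlt
    have hle : L n < (⌊c * √(n : ℝ)⌋₊ : ℕ) := by
      by_contra! hle
      have := (totalB_le_totalD_iff_meanRatio hfl.1 hfl.2).1 ((hL n hn0 _ hfl.2).2 hle)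
      linarith
    exact lt_of_le_of_lt (by gcongr) hlt

end OrderedTree

theorem theorem1p2 :
    (∀ n : ℕ, 1 ≤ n → ∃ t : ℝ, OrderedTree.IsThreshold n t) ∧
    (∀ n : ℕ, 1 ≤ n → ∀ l : ℕ, l < n →
      (OrderedTree.targets n l).Nonempty ∧
      (OrderedTree.averageB n l ≤ OrderedTree.averageD n l ↔
        OrderedTree.totalB n l ≤ OrderedTree.totalD n l)) ∧
    (∃ lam : ℝ,
      (0 < lam ∧ thresholdFun lam = 0) ∧
      (∀ x : ℝ, 0 < x → thresholdFun x = 0 → x = lam) ∧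
      |lam - 0.789004| ≤ 5 / 10 ^ 7 ∧
      ∀ L : ℕ → ℝ, (∀ n : ℕ, 1 ≤ n → OrderedTree.IsThreshold n (L n)) →
        Asymptotics.IsEquivalent Filter.atTop L (fun n : ℕ => lam * Real.sqrt (n : ℝ))) := by
  refine ⟨fun n hn => OrderedTree.exists_isThreshold hn, fun n _ l hl =>
    ⟨OrderedTree.targets_nonempty hl.le, OrderedTree.averageB_le_averageD_iff hl.le⟩, ?_⟩
  obtain ⟨lam, hpos, hone, hnum⟩ := exists_limitRatio_eq_one
  refine ⟨lam, ⟨hpos, by simp [thresholdFun_eq, hone]⟩, fun x hx h => ?_, hnum, fun L hL => ?_⟩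
  · rw [thresholdFun_eq, mul_eq_zero, sub_eq_zero] at h
    have hx1 : limitRatio x = 1 :=
      (h.resolve_left (mul_ne_zero hx.ne' (Real.exp_ne_zero _))).symm
    rcases lt_trichotomy x lam with hlt | heq | hgt
    · have := limitRatio_lt hx.le hlt
      linarith
    · exact heq
    · have := limitRatio_lt hpos.le hgt
      linarith
  · have h := (OrderedTree.tendsto_threshold_div_sqrt hpos hone hL).div_const lam
    rw [div_self hpos.ne'] at h
    have hne : ∀ᶠ n : ℕ in atTop, lam * √(n : ℝ) ≠ 0 := by
      filter_upwards [eventually_gt_atTop 0] with n hn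
      positivity
    rw [Asymptotics.isEquivalent_iff_tendsto_one hne]
    refine h.congr fun n => ?_
    rw [Pi.div_apply, div_div, mul_comm lam]
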